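/- Let $G$ be a hyperbolic group, possibly with torsion, and let $X$ be a finite generating set for $G$, i.e. a finite set with an epimorphism $F(X)\to G$ from the free group on $X$. Let $d_G$ denote the associated word metric, $d_G(g,h)$ being the length of a shortest word in the letters $X^{\pm1}$ that represents $g^{-1}h$. For $a\in G$ let $\langle\!\langle a\rangle\!\rangle$ be the normal closure of $a$ in $G$, and regard $X$ as a generating set for $G/\langle\!\langle a\rangle\!\rangle$ through the composite $F(X)\to G\to G/\langle\!\langle a\rangle\!\rangle$, with word metric $d_{G/\langle\!\langle a\rangle\!\rangle}$. Then, for each $a\in G$ of infinite order, there exist non-negative integers $K$ and $N$ such that for every $h\in G$ with $$d_G(1,h)=d_{G/\langle\!\langle a\rangle\!\rangle}\bigl(\langle\!\langle a\rangle\!\rangle,\,h\langle\!\langle a\rangle\!\rangle\bigr)>N,$$ the element $ha^K$ is not a proper power in $G$, that is, there are no $g\in G$ and $p\ge 2$ with $g^p=ha^K$. -/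

import Mathlib

/-! Word metrics, hyperbolic groups and proper powers. A choice of generators `X` for a group `G`
is a surjective homomorphism `φ : FreeGroup X →* G`; composing it with a quotient map
`G →* Q` makes `X` a set of generators for `Q`. -/

/-- The word length of `g` with respect to the generators `φ : FreeGroup X →* G`: the minimal
length of a word in the letters `x`, `x⁻¹` (`x : X`) that represents `g`. -/
noncomputable def wordLength {X G : Type*} [Group G] (φ : FreeGroup X →* G) (g : G) : ℕ :=
  sInf {n : ℕ | ∃ w : List (X × Bool), φ (FreeGroup.mk w) = g ∧ w.length = n}

/-- The word metric: the distance between the vertices `g` and `h` of the Cayley graph of `G`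
with respect to the generators `φ` (its edges join `g` to `g * φ x`). -/
noncomputable def wordDist {X G : Type*} [Group G] (φ : FreeGroup X →* G) (g h : G) : ℕ :=
  wordLength φ (g⁻¹ * h)

/-- `p 0, p 1, …, p n` are the successive vertices of a geodesic edge path of length `n` from `x`
to `y` in the Cayley graph. -/
def IsGeodesicPath {X G : Type*} [Group G] (φ : FreeGroup X →* G) (p : ℕ → G) (n : ℕ)
    (x y : G) : Prop :=
  p 0 = x ∧ p n = y ∧ ∀ i j : ℕ, i ≤ j → j ≤ n → wordDist φ (p i) (p j) = j - i

/-- Every geodesic triangle in the Cayley graph is `δ`-slim: each side is contained in the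
`δ`-neighbourhood of the union of the other two. It is enough to state this for one side, because
the three sides `p, q, r` of a triangle can be permuted cyclically. -/
def HasSlimTriangles {X G : Type*} [Group G] (φ : FreeGroup X →* G) (δ : ℕ) : Prop :=
  ∀ (x y z : G) (p q r : ℕ → G) (l m n : ℕ),
    IsGeodesicPath φ p l x y → IsGeodesicPath φ q m y z → IsGeodesicPath φ r n z x →
    ∀ i ≤ l, (∃ j ≤ m, wordDist φ (p i) (q j) ≤ δ) ∨ (∃ j ≤ n, wordDist φ (p i) (r j) ≤ δ)

/-- `G` is a hyperbolic group: for some finite set of generators and some `δ`, all geodesic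
triangles in the Cayley graph are `δ`-slim. -/
def IsHyperbolicGroup (G : Type*) [Group G] : Prop :=
  ∃ (k : ℕ) (φ : FreeGroup (Fin k) →* G), Function.Surjective φ ∧ ∃ δ : ℕ, HasSlimTriangles φ δ

/-- `g` is a proper power: `g = x ^ p` for some `x` and some `p ≥ 2`. -/
def IsProperPower {G : Type*} [Group G] (g : G) : Prop :=
  ∃ (x : G) (p : ℕ), 2 ≤ p ∧ x ^ p = g

/-! Some power `b` of `a` generates a quasi-geodesic subgroup (`exists_quasigeodesic_pow`). If `h`
is shortest modulo `⟨⟨a⟩⟩`, a geodesic from 1 to `h` stays geodesic in the quotient, while a stretch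
along a translate of `⟨b⟩` collapses there. So such overlaps are bounded
(`exists_hasBoundedOverlap`), with no dependence on `h`.

Hence, for `K` and `h` large, the translates of `[1, h]` and `[h, h * b ^ K]` by powers of `w = h *
b ^ K` join into a nearly straight axis (`exists_axis`). An element `c` commuting with `w` coarsely
preserves this axis. It must also match the `b`-segments, which cannot run along `h`-segments, so `c
* h` is uniformly close to some `w ^ n * h` (`exists_zpow_dist_le`).

If `g ^ p = w`, then `c = w ^ (-n) * g` moves `h` little. All its powers do too, since distinct
points `w ^ k * h` are far apart. But `c ^ p = w ^ (1 - n * p)`, so `n * p = 1`, which excludes `p ≥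
2`. Torsion is harmless because only coarse displacements are compared. -/

section WordMetric

/-! ### Word lengths and geodesics in Cayley graphs. -/

variable {X Y G Q : Type*} [Group G] [Group Q]

theorem wordLength_mk_le (φ : FreeGroup X →* G) (w : List (X × Bool)) :
    wordLength φ (φ (FreeGroup.mk w)) ≤ w.length :=
  Nat.sInf_le ⟨w, rfl, rfl⟩

theorem exists_word_of_surjective {φ : FreeGroup X →* G} (hφ : Function.Surjective φ) (g : G) :
    ∃ w : List (X × Bool), φ (FreeGroup.mk w) = g ∧ w.length = wordLength φ g := by
  have h : {n : ℕ | ∃ w : List (X × Bool), φ (FreeGroup.mk w) = g ∧ w.length = n}.Nonempty := by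
    classical
    obtain ⟨x, rfl⟩ := hφ g
    exact ⟨x.toWord.length, x.toWord, by rw [FreeGroup.mk_toWord], rfl⟩
  exact Nat.sInf_mem h

theorem wordLength_one (φ : FreeGroup X →* G) : wordLength φ 1 = 0 := by
  have := wordLength_mk_le φ []
  rwa [← FreeGroup.one_eq_mk, map_one, List.length_nil, Nat.le_zero] at this

theorem wordLength_mul_le {φ : FreeGroup X →* G} (hφ : Function.Surjective φ) (g h : G) :
    wordLength φ (g * h) ≤ wordLength φ g + wordLength φ h := by
  obtain ⟨v, rfl, hv⟩ := exists_word_of_surjective hφ g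
  obtain ⟨w, rfl, hw⟩ := exists_word_of_surjective hφ h
  rw [← hv, ← hw, ← map_mul, FreeGroup.mul_mk, ← List.length_append]
  exact wordLength_mk_le φ _

theorem wordLength_inv_le {φ : FreeGroup X →* G} (hφ : Function.Surjective φ) (g : G) :
    wordLength φ g⁻¹ ≤ wordLength φ g := by
  obtain ⟨v, rfl, hv⟩ := exists_word_of_surjective hφ g
  rw [← hv, ← map_inv, FreeGroup.inv_mk, ← FreeGroup.invRev_length (L₁ := v)]
  exact wordLength_mk_le φ _

theorem wordLength_inv {φ : FreeGroup X →* G} (hφ : Function.Surjective φ) (g : G) :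
    wordLength φ g⁻¹ = wordLength φ g :=
  le_antisymm (wordLength_inv_le hφ g) (by simpa using wordLength_inv_le hφ g⁻¹)

theorem wordDist_self (φ : FreeGroup X →* G) (g : G) : wordDist φ g g = 0 := by
  simp [wordDist, wordLength_one]

theorem wordDist_comm {φ : FreeGroup X →* G} (hφ : Function.Surjective φ) (g h : G) :
    wordDist φ g h = wordDist φ h g := by
  rw [wordDist, ← wordLength_inv hφ, mul_inv_rev, inv_inv, wordDist]

theorem wordDist_triangle {φ : FreeGroup X →* G} (hφ : Function.Surjective φ) (g h k : G) :
    wordDist φ g k ≤ wordDist φ g h + wordDist φ h k := by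
  simpa [wordDist, mul_assoc] using wordLength_mul_le hφ (g⁻¹ * h) (h⁻¹ * k)

theorem wordDist_mul_left (φ : FreeGroup X →* G) (g x y : G) :
    wordDist φ (g * x) (g * y) = wordDist φ x y := by
  simp [wordDist, mul_assoc]

theorem exists_isGeodesicPath {φ : FreeGroup X →* G} (hφ : Function.Surjective φ) (x y : G) :
    ∃ p : ℕ → G, IsGeodesicPath φ p (wordDist φ x y) x y := by
  obtain ⟨w, hw, hl⟩ := exists_word_of_surjective hφ (x⁻¹ * y)
  have hl' : w.length = wordDist φ x y := hl
  set p : ℕ → G := fun i => x * φ (FreeGroup.mk (w.take i)) with hp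
  have h0 : p 0 = x := by
    simp only [hp, List.take_zero]
    rw [← FreeGroup.one_eq_mk, map_one, mul_one]
  have hn : p (wordDist φ x y) = y := by
    simp only [hp]
    rw [← hl', List.take_length, hw, mul_inv_cancel_left]
  have hle : ∀ i j, i ≤ j → wordDist φ (p i) (p j) ≤ j - i := by
    intro i j hij
    have hsplit : w.take j = w.take i ++ (w.drop i).take (j - i) := by
      rw [← List.take_add]; congr 1; omega
    simp only [hp]
    rw [wordDist_mul_left, hsplit, ← FreeGroup.mul_mk, map_mul, wordDist, inv_mul_cancel_left]
    exact (wordLength_mk_le φ _).trans (by rw [List.length_take]; exact min_le_left _ _)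
  refine ⟨p, h0, hn, fun i j hij hj => le_antisymm (hle i j hij) ?_⟩
  have h1 := hle 0 i (Nat.zero_le i)
  have h2 := hle j _ hj
  have h3 := wordDist_triangle hφ (p 0) (p i) (p (wordDist φ x y))
  have h4 := wordDist_triangle hφ (p i) (p j) (p (wordDist φ x y))
  have h5 : wordDist φ (p 0) (p (wordDist φ x y)) = wordDist φ x y := by rw [h0, hn]
  omega

theorem finite_wordLength_le [Finite X] {φ : FreeGroup X →* G} (hφ : Function.Surjective φ)
    (n : ℕ) : {g : G | wordLength φ g ≤ n}.Finite := by
  refine ((List.finite_length_le (X × Bool) n).image fun w => φ (FreeGroup.mk w)).subset ?_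
  intro g hg
  obtain ⟨w, hw, hl⟩ := exists_word_of_surjective hφ g
  exact ⟨w, by simpa [hl] using hg, hw⟩

/-- Needed because hyperbolicity comes with its own generators, while minimality of `h` refers to
the given ones. -/
theorem exists_wordLength_le_mul [Finite Y] {φ : FreeGroup X →* G} (hφ : Function.Surjective φ)
    {ψ : FreeGroup Y →* G} (hψ : Function.Surjective ψ) :
    ∃ c : ℕ, ∀ g : G, wordLength φ g ≤ c * wordLength ψ g := by
  obtain ⟨c, hc⟩ := Finite.exists_le fun y : Y × Bool => wordLength φ (ψ (FreeGroup.mk [y]))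
  have key : ∀ w : List (Y × Bool), wordLength φ (ψ (FreeGroup.mk w)) ≤ c * w.length := by
    intro w
    induction w with
    | nil => rw [← FreeGroup.one_eq_mk, map_one, wordLength_one]; exact Nat.zero_le _
    | cons y w ih =>
      have h1 : FreeGroup.mk (y :: w) = FreeGroup.mk [y] * FreeGroup.mk w := by
        rw [FreeGroup.mul_mk, List.singleton_append]
      rw [h1, map_mul, List.length_cons, mul_add, mul_one, add_comm]
      exact (wordLength_mul_le hφ _ _).trans (add_le_add (hc y) ih)
  refine ⟨c, fun g => ?_⟩
  obtain ⟨w, rfl, hl⟩ := exists_word_of_surjective hψ g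
  rw [← hl]
  exact key w

theorem wordLength_comp_le {φ : FreeGroup X →* G} (hφ : Function.Surjective φ) (f : G →* Q)
    (g : G) : wordLength (f.comp φ) (f g) ≤ wordLength φ g := by
  obtain ⟨w, rfl, hl⟩ := exists_word_of_surjective hφ g
  rw [← hl]
  exact wordLength_mk_le (f.comp φ) w

end WordMetric

/-- A left invariant, geodesic, proper metric with values in `ℕ` on a group that satisfies the
four point condition with constant `δ`. -/
structure IsHyperbolicMetric {G : Type*} [Group G] (d : G → G → ℕ) (δ : ℕ) : Prop where
  self : ∀ x, d x x = 0
  symm : ∀ x y, d x y = d y x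
  triangle : ∀ x y z, d x z ≤ d x y + d y z
  mul_left : ∀ g x y, d (g * x) (g * y) = d x y
  four_point : ∀ x y z w, d x z + d y w ≤ d x y + d z w + δ ∨ d x z + d y w ≤ d x w + d y z + δ
  exists_geodesic : ∀ x y, ∃ p : ℕ → G, p 0 = x ∧ p (d x y) = y ∧
    ∀ i j, i ≤ j → j ≤ d x y → d (p i) (p j) = j - i
  finite_ball : ∀ n, {g | d 1 g ≤ n}.Finite

/-! ### From slim triangles to the four point condition. -/

section SlimTriangles

variable {X G : Type*} [Group G]

/-- A side of a slim triangle has a vertex that is close to both of the other sides. -/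
theorem HasSlimTriangles.exists_center {φ : FreeGroup X →* G} (hφ : Function.Surjective φ) {δ : ℕ}
    (hδ : HasSlimTriangles φ δ) {x y : G} {p : ℕ → G}
    (hp : IsGeodesicPath φ p (wordDist φ x y) x y) (z : G) :
    ∃ i ≤ wordDist φ x y,
      wordDist φ x (p i) + wordDist φ (p i) z ≤ wordDist φ x z + (2 * δ + 2) ∧
      wordDist φ y (p i) + wordDist φ (p i) z ≤ wordDist φ y z + (2 * δ + 2) := by
  classical
  obtain ⟨q, hq⟩ := exists_isGeodesicPath hφ y z
  obtain ⟨r, hr⟩ := exists_isGeodesicPath hφ z x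
  have slim := hδ x y z p q r _ _ _ hp hq hr
  have tri := wordDist_triangle hφ
  have comm := wordDist_comm hφ
  have near_q : ∀ i, (∃ j ≤ wordDist φ y z, wordDist φ (p i) (q j) ≤ δ) →
      wordDist φ y (p i) + wordDist φ (p i) z ≤ wordDist φ y z + 2 * δ := by
    rintro i ⟨j, hj, hij⟩
    have h1 := hq.2.2 0 j (Nat.zero_le _) hj
    have h2 := hq.2.2 j _ hj le_rfl
    rw [hq.1] at h1
    rw [hq.2.1] at h2
    have := tri y (q j) (p i)
    have := tri (p i) (q j) z
    have := comm (p i) (q j)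
    omega
  have near_r : ∀ i, (∃ j ≤ wordDist φ z x, wordDist φ (p i) (r j) ≤ δ) →
      wordDist φ x (p i) + wordDist φ (p i) z ≤ wordDist φ x z + 2 * δ := by
    rintro i ⟨j, hj, hij⟩
    have h1 := hr.2.2 0 j (Nat.zero_le _) hj
    have h2 := hr.2.2 j _ hj le_rfl
    rw [hr.1] at h1
    rw [hr.2.1] at h2
    have := tri x (r j) (p i)
    have := tri (p i) (r j) z
    have := comm (p i) (r j)
    have := comm z (r j)
    have := comm x (r j)
    have := comm x z
    omega
  -- Take the first vertex near the side `q`. Its predecessor is not near `q`, hence is near `r`;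
  -- moving one edge costs the extra 2.
  have hex : ∃ i, i ≤ wordDist φ x y ∧ ∃ j ≤ wordDist φ y z, wordDist φ (p i) (q j) ≤ δ :=
    ⟨_, le_rfl, 0, Nat.zero_le _, by rw [hp.2.1, hq.1, wordDist_self]; exact Nat.zero_le _⟩
  obtain ⟨hi, hiq⟩ := Nat.find_spec hex
  refine ⟨Nat.find hex, hi, ?_, (near_q _ hiq).trans (by omega)⟩
  rcases Nat.eq_zero_or_pos (Nat.find hex) with h0 | hpos
  · rw [h0, hp.1, wordDist_self]
    omega
  · have hlt := Nat.find_min hex (Nat.sub_lt hpos one_pos)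
    have hle : Nat.find hex - 1 ≤ wordDist φ x y := by omega
    have h1 := near_r _ ((slim _ hle).resolve_left fun h => hlt ⟨hle, h⟩)
    have h2 := hp.2.2 (Nat.find hex - 1) (Nat.find hex) (by omega) hi
    have := tri x (p (Nat.find hex - 1)) (p (Nat.find hex))
    have := tri (p (Nat.find hex)) (p (Nat.find hex - 1)) z
    have := comm (p (Nat.find hex)) (p (Nat.find hex - 1))
    omega

theorem HasSlimTriangles.isHyperbolicMetric [Finite X] {φ : FreeGroup X →* G}
    (hφ : Function.Surjective φ) {δ : ℕ} (hδ : HasSlimTriangles φ δ) :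
    IsHyperbolicMetric (wordDist φ) (4 * δ + 4) where
  self := wordDist_self φ
  symm := wordDist_comm hφ
  triangle := wordDist_triangle hφ
  mul_left := wordDist_mul_left φ
  exists_geodesic x y := by
    obtain ⟨p, hp⟩ := exists_isGeodesicPath hφ x y
    exact ⟨p, hp.1, hp.2.1, hp.2.2⟩
  finite_ball n := by simpa [wordDist] using finite_wordLength_le hφ n
  four_point x z y w := by
    obtain ⟨p, hp⟩ := exists_isGeodesicPath hφ x y
    obtain ⟨i, hi, hi1, hi2⟩ := hδ.exists_center hφ hp z
    obtain ⟨j, hj, hj1, hj2⟩ := hδ.exists_center hφ hp w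
    have hxi := hp.2.2 0 i (Nat.zero_le _) hi
    have hxj := hp.2.2 0 j (Nat.zero_le _) hj
    have hiy := hp.2.2 i _ hi le_rfl
    have hjy := hp.2.2 j _ hj le_rfl
    rw [hp.1] at hxi hxj
    rw [hp.2.1] at hiy hjy
    have tri := wordDist_triangle hφ
    have comm := wordDist_comm hφ
    have := comm y (p i)
    have := comm y (p j)
    have := comm (p i) z
    have := comm (p i) (p j)
    have := comm (p j) w
    have := comm y z
    have := comm y w
    have := tri z (p i) w
    have := tri (p i) (p j) w
    -- The order of the two centres on `[x, y]` decides which pairing of the four points is the long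
    -- one.
    rcases le_total i j with h | h
    · have hij := hp.2.2 i j h hj
      right; omega
    · have hij := hp.2.2 j i h hi
      left; omega

end SlimTriangles

/-! ### Nearly straight triples. -/

namespace IsHyperbolicMetric

variable {G : Type*} [Group G] {d : G → G → ℕ} {δ : ℕ}

/-- The bisection device: a point near a side of a triangle is near one of the other two, at a cost
of `δ`. -/
theorem split (H : IsHyperbolicMetric d δ) {C : ℕ} {x y z : G}
    (h : d x z + d z y ≤ d x y + C) (m : G) :
    d x z + d z m ≤ d x m + (C + δ) ∨ d m z + d z y ≤ d m y + (C + δ) := by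
  have := H.symm z m
  have := H.symm z x
  have := H.symm m x
  have := H.symm y z
  rcases H.four_point x m y z with h1 | h1
  · left; omega
  · right; omega

/-- Points close to a geodesic are determined by their distance from its origin. -/
theorem dist_le_of_between (H : IsHyperbolicMetric d δ) {C r : ℕ} {x y p q : G}
    (hp : d x p + d p y ≤ d x y + C) (hq : d x q + d q y ≤ d x y + C)
    (h1 : d x p ≤ d x q + r) (h2 : d x q ≤ d x p + r) : d p q ≤ r + C + δ := by
  have := H.symm p q
  have := H.symm q y
  have := H.symm p y
  rcases H.four_point x p y q with h | h <;> omega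

/-- A nearly straight triple stays nearly straight when its first point is moved by a
comparatively small distance. -/
theorem between_of_far (H : IsHyperbolicMetric d δ) {C : ℕ} {x x' u v : G}
    (h : d x u + d u v ≤ d x v + C) (hfar : d x x' + C + δ < d x u) :
    d x' u + d u v ≤ d x' v + (C + δ) := by
  have := H.symm v x'
  have := H.symm u x'
  rcases H.four_point x u v x' with h1 | h1 <;> omega

theorem between_symm (H : IsHyperbolicMetric d δ) {C : ℕ} {x y z : G}
    (h : d x z + d z y ≤ d x y + C) : d y z + d z x ≤ d y x + C := by
  have := H.symm x z
  have := H.symm x y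
  have := H.symm z y
  omega

/-! ### From local to global straightness. -/

section LocalToGlobal

/-- In the four point condition for `x i` and the last three points, one alternative would make the
middle step at most `C + δ`. The other returns the same error `C + δ`, so errors do not accumulate.
-/
theorem between_succ_of_local (H : IsHyperbolicMetric d δ) {C : ℕ} {x : ℤ → G}
    (hloc : ∀ i, d (x i) (x (i + 1)) + d (x (i + 1)) (x (i + 2)) ≤ d (x i) (x (i + 2)) + C)
    (hlong : ∀ i, C + δ < d (x i) (x (i + 1))) (i : ℤ) (n : ℕ) :
    d (x i) (x (i + n)) + d (x (i + n)) (x (i + n + 1)) ≤ d (x i) (x (i + n + 1)) + (C + δ) := by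
  induction n with
  | zero => simp [H.self]
  | succ n ih =>
    have h1 := hloc (i + n)
    have h2 := hlong (i + n)
    have e1 : i + ((n + 1 : ℕ) : ℤ) = i + n + 1 := by push_cast; ring
    have e2 : i + (n : ℤ) + 2 = i + n + 1 + 1 := by ring
    rw [e2] at h1
    rw [e1]
    have := H.symm (x (i + n)) (x (i + n + 1))
    rcases H.four_point (x i) (x (i + n)) (x (i + n + 1)) (x (i + n + 1 + 1)) with h | h <;> omega

/-- A sequence with long steps that is nearly straight locally is nearly straight globally. -/
theorem between_of_local (H : IsHyperbolicMetric d δ) {C : ℕ} {x : ℤ → G}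
    (hloc : ∀ i, d (x i) (x (i + 1)) + d (x (i + 1)) (x (i + 2)) ≤ d (x i) (x (i + 2)) + C)
    (hlong : ∀ i, C + 2 * δ < d (x i) (x (i + 1))) {i j k : ℤ} (hij : i ≤ j) (hjk : j ≤ k) :
    d (x i) (x j) + d (x j) (x k) ≤ d (x i) (x k) + (C + 2 * δ) := by
  have hlong' : ∀ i, C + δ < d (x i) (x (i + 1)) := fun i => by have := hlong i; omega
  have fwd : ∀ i j : ℤ, i ≤ j →
      d (x i) (x j) + d (x j) (x (j + 1)) ≤ d (x i) (x (j + 1)) + (C + δ) := by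
    intro i j hij
    obtain ⟨n, rfl⟩ := Int.le.dest hij
    exact H.between_succ_of_local hloc hlong' i n
  have bwd : ∀ j k : ℤ, j + 1 ≤ k →
      d (x j) (x (j + 1)) + d (x (j + 1)) (x k) ≤ d (x j) (x k) + (C + δ) := by
    intro j k hjk
    obtain ⟨n, rfl⟩ := Int.le.dest hjk
    have key := H.between_succ_of_local (x := fun i => x (-i)) (C := C)
      (fun i => by
        have := hloc (-(i + 2))
        rw [show -(i + 2) + 1 = -(i + 1) by ring, show -(i + 2) + 2 = -i by ring] at this
        exact H.between_symm this)
      (fun i => by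
        have := hlong' (-(i + 1))
        rw [show -(i + 1) + 1 = -i by ring] at this
        simpa only [H.symm (x (-i))] using this) (-(j + 1 + n)) n
    simp only [show -(-(j + 1 + (n : ℤ)) + n) = j + 1 by ring,
      show -(-(j + 1 + (n : ℤ)) + n + 1) = j by ring, neg_neg] at key
    exact H.between_symm key
  rcases hij.eq_or_lt with rfl | hij
  · simp [H.self]
  rcases hjk.eq_or_lt with rfl | hjk
  · simp [H.self]
  have h1 := fwd i j hij.le
  have h2 := bwd j k hjk
  have h3 := hlong j
  have := H.symm (x k) (x (j + 1))
  have := H.symm (x j) (x (j + 1))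
  rcases H.four_point (x i) (x j) (x (j + 1)) (x k) with h | h <;> omega

theorem le_dist_of_local (H : IsHyperbolicMetric d δ) {C : ℕ} {x : ℤ → G}
    (hloc : ∀ i, d (x i) (x (i + 1)) + d (x (i + 1)) (x (i + 2)) ≤ d (x i) (x (i + 2)) + C)
    (hlong : ∀ i, C + 2 * δ < d (x i) (x (i + 1))) (i : ℤ) (n : ℕ) :
    n ≤ d (x i) (x (i + n)) := by
  induction n with
  | zero => exact Nat.zero_le _
  | succ n ih =>
    have h1 := H.between_of_local hloc hlong (i := i) (j := i + n) (k := i + n + 1)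
      (by omega) (by omega)
    have h2 := hlong (i + n)
    push_cast
    rw [← add_assoc]
    omega

end LocalToGlobal

/-! ### Stability of quasi-geodesics. -/

section Morse

/-- A point close to a geodesic is at logarithmic distance from any path with the same ends. -/
theorem exists_dist_le_log (H : IsHyperbolicMetric d δ) {μ : ℕ} {u : ℕ → G}
    (hu : ∀ i, d (u i) (u (i + 1)) ≤ μ) {z : G} (k : ℕ) : ∀ {C i j : ℕ}, i ≤ j → j ≤ i + 2 ^ k →
      d (u i) z + d z (u j) ≤ d (u i) (u j) + C → ∃ l, i ≤ l ∧ l ≤ j ∧ d z (u l) ≤ C + k * δ + μ := by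
  induction k with
  | zero =>
    intro C i j hij hj h
    refine ⟨j, hij, le_rfl, ?_⟩
    rcases hij.eq_or_lt with rfl | hlt
    · rw [H.self] at h; omega
    · obtain rfl : j = i + 1 := by omega
      have := hu i
      omega
  | succ k ih =>
    intro C i j hij hj h
    rw [pow_succ] at hj
    rw [add_mul, one_mul]
    by_cases hsmall : j ≤ i + 2 ^ k
    · obtain ⟨l, h1, h2, h3⟩ := ih hij hsmall h
      exact ⟨l, h1, h2, by omega⟩
    rcases H.split h (u (i + 2 ^ k)) with h' | h'
    · obtain ⟨l, h1, h2, h3⟩ := ih (by omega) (by omega) h'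
      exact ⟨l, h1, by omega, by omega⟩
    · obtain ⟨l, h1, h2, h3⟩ := ih (by omega) (by omega) h'
      exact ⟨l, by omega, h2, by omega⟩

/-- Exponential growth beats linear growth: an inequality `D ≤ A + E * log₂ (B * D)` bounds `D`. -/
theorem exists_log_bound (A B E : ℕ) :
    ∃ D₀ : ℕ, ∀ D, D₀ < D → ∃ k, B * D ≤ 2 ^ k ∧ A + k * E < D := by
  have hlim := (tendsto_pow_const_div_const_pow_of_one_lt 1 (one_lt_two (α := ℝ))).eventually
    (gt_mem_nhds (show (0 : ℝ) < 1 / (2 * B * (A + E + 1) + 1) by positivity))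
  obtain ⟨k₀, hk₀⟩ := Filter.eventually_atTop.1 hlim
  have hk : ∀ k, k₀ < k → 2 * B * (A + E + 1) * k ≤ 2 ^ k := by
    intro k hk
    have h := hk₀ k hk.le
    rw [pow_one, div_lt_div_iff₀ (by positivity) (by positivity), one_mul] at h
    have hk' : (0 : ℝ) ≤ k := Nat.cast_nonneg k
    have : (2 * B * (A + E + 1) * k : ℝ) ≤ 2 ^ k := by nlinarith
    exact_mod_cast this
  refine ⟨(A + E + 1) * (k₀ + 2), fun D hD => ⟨(D - 1) / (A + E + 1), ?_, ?_⟩⟩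
  all_goals
    have hM : 0 < A + E + 1 := by omega
    have hk1 : k₀ + 2 ≤ (D - 1) / (A + E + 1) := by
      rw [Nat.le_div_iff_mul_le hM, mul_comm]
      omega
    have hk2 := Nat.div_mul_le_self (D - 1) (A + E + 1)
    have hk3 := Nat.lt_div_mul_add (a := D - 1) hM
    set k := (D - 1) / (A + E + 1)
    have hk4 : A + E + 1 ≤ k * (A + E + 1) := Nat.le_mul_of_pos_left _ (by omega)
  · refine le_trans ?_ (hk k (by omega))
    have : D ≤ 2 * (k * (A + E + 1)) := by omega
    calc B * D ≤ B * (2 * (k * (A + E + 1))) := Nat.mul_le_mul_left B this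
      _ = _ := by ring
  · have h1 : A ≤ k * A := Nat.le_mul_of_pos_left _ (by omega)
    rw [mul_add, mul_add] at hk2
    omega

/-- Geodesics stay close to quasi-geodesics with the same ends. -/
theorem exists_morse_constant (H : IsHyperbolicMetric d δ) (μ c : ℕ) :
    ∃ D : ℕ, ∀ (u : ℕ → G) (n : ℕ), (∀ i, d (u i) (u (i + 1)) ≤ μ) →
      (∀ i j, i ≤ j → j ≤ n → j - i ≤ c * d (u i) (u j)) →
      ∀ (C : ℕ) (z : G), d (u 0) z + d z (u n) ≤ d (u 0) (u n) + C →
        ∃ l ≤ n, d z (u l) ≤ D + 2 * C := by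
  classical
  obtain ⟨D₀, hD₀⟩ := exists_log_bound (2 * δ + μ) (c * 6) δ
  refine ⟨D₀ + 2 * δ + δ, fun u n hu hqi => ?_⟩
  obtain ⟨p, hp0, hpn, hp⟩ := H.exists_geodesic (u 0) (u n)
  set m := d (u 0) (u n) with hm
  have near : ∀ i ≤ m, ∃ l ≤ n, d (p i) (u l) ≤ D₀ + 2 * δ := by
    have hex : ∃ D, ∀ i ≤ m, ∃ l ≤ n, d (p i) (u l) ≤ D := by
      refine ⟨m, fun i hi => ⟨0, Nat.zero_le _, ?_⟩⟩
      have := hp 0 i (Nat.zero_le _) hi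
      rw [hp0, H.symm] at this
      omega
    by_contra hcon
    -- The least radius that works: some `p i` has distance at least `D` from the whole path. Going
    -- about `2 * D` along the geodesic to either side and jumping to the path gives path points at
    -- distance at most `6 * D`, with `p i` nearly between them. The logarithmic bound then yields a
    -- path point closer than `D`.
    set D := Nat.find hex with hD
    have hspec : ∀ i ≤ m, ∃ l ≤ n, d (p i) (u l) ≤ D := Nat.find_spec hex
    have hbig : D₀ + 2 * δ < D := by
      by_contra hle
      refine hcon fun i hi => ?_
      obtain ⟨l, hl, hle'⟩ := hspec i hi
      exact ⟨l, hl, by omega⟩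
    have hmin := Nat.find_min hex (m := D - 1) (by omega)
    push Not at hmin
    obtain ⟨i, hi, hfar⟩ := hmin
    obtain ⟨i₁, hi₁, l₁, hl₁, hd₁, hc₁⟩ : ∃ i₁ ≤ i, ∃ l₁ ≤ n, d (p i₁) (u l₁) + (i - i₁) ≤ 3 * D ∧
        2 * D + d (p i₁) (u l₁) ≤ d (p i₁) (p i) + d (p i) (u l₁) := by
      by_cases h : 2 * D ≤ i
      · obtain ⟨l, hl, hle⟩ := hspec (i - 2 * D) (by omega)
        refine ⟨i - 2 * D, by omega, l, hl, by omega, ?_⟩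
        have := hp (i - 2 * D) i (by omega) hi
        have := hfar l hl
        omega
      · refine ⟨0, by omega, 0, Nat.zero_le _, ?_, ?_⟩
        · rw [hp0, H.self]; omega
        · have := hfar 0 (Nat.zero_le _)
          rw [hp0, H.self, H.symm (u 0)]
          omega
    obtain ⟨i₂, hi₂, hi₂m, l₂, hl₂, hd₂, hc₂⟩ : ∃ i₂, i ≤ i₂ ∧ i₂ ≤ m ∧ ∃ l₂ ≤ n,
        d (p i₂) (u l₂) + (i₂ - i) ≤ 3 * D ∧
        2 * D + d (u l₂) (p i₂) ≤ d (u l₂) (p i) + d (p i) (p i₂) := by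
      by_cases h : i + 2 * D ≤ m
      · obtain ⟨l, hl, hle⟩ := hspec (i + 2 * D) (by omega)
        refine ⟨i + 2 * D, by omega, h, l, hl, by omega, ?_⟩
        have := hp i (i + 2 * D) (by omega) h
        have := hfar l hl
        have := H.symm (p i) (u l)
        have := H.symm (p (i + 2 * D)) (u l)
        omega
      · refine ⟨m, hi, le_rfl, n, le_rfl, ?_, ?_⟩
        · rw [hpn, H.self]; omega
        · have := hfar n le_rfl
          rw [hpn, H.self, H.symm (u n)]
          omega
    have e1 := hp i₁ i hi₁ hi
    have e2 := hp i i₂ hi₂ hi₂m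
    have e3 := hp i₁ i₂ (hi₁.trans hi₂) hi₂m
    have hbt : d (p i₁) (p i) + d (p i) (p i₂) ≤ d (p i₁) (p i₂) + 0 := by omega
    have hbt2 : d (u l₁) (p i) + d (p i) (u l₂) ≤ d (u l₁) (u l₂) + 2 * δ := by
      rcases H.split hbt (u l₁) with h | h
      · omega
      · rcases H.split h (u l₂) with h' | h' <;> omega
    have hdist : d (u l₁) (u l₂) ≤ 6 * D := by
      have := H.triangle (u l₁) (p i₁) (u l₂)
      have := H.triangle (p i₁) (p i₂) (u l₂)
      have := H.symm (u l₁) (p i₁)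
      omega
    obtain ⟨k, hk1, hk2⟩ := hD₀ D (by omega)
    have hcD : c * d (u l₁) (u l₂) ≤ 2 ^ k :=
      (Nat.mul_le_mul_left c hdist).trans (by rwa [← mul_assoc])
    rcases le_total l₁ l₂ with h | h
    · have := hqi l₁ l₂ h hl₂
      obtain ⟨l, h1, h2, h3⟩ := H.exists_dist_le_log hu k h (by omega) hbt2
      have := hfar l (by omega)
      omega
    · have := hqi l₂ l₁ h hl₁
      rw [H.symm] at hcD
      obtain ⟨l, h1, h2, h3⟩ := H.exists_dist_le_log hu k h (by omega) (H.between_symm hbt2)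
      have := hfar l (by omega)
      omega
  intro C z hz
  set i := min (d (u 0) z) m with hidef
  have him : i ≤ m := min_le_right _ _
  have e1 := hp 0 i (Nat.zero_le _) him
  have e2 := hp i m him le_rfl
  rw [hp0] at e1
  rw [hpn] at e2
  -- `z` is compared with the geodesic point at the same distance from `u 0`, up to the truncation
  -- at `m`, which costs at most `C`.
  have hzi : d z (p i) ≤ C + C + δ :=
    H.dist_le_of_between (x := u 0) (y := u n) hz (by omega) (by omega) (by omega)
  obtain ⟨l, hl, hle⟩ := near i him
  have := H.triangle z (p i) (u l)
  exact ⟨l, hl, by omega⟩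

end Morse

end IsHyperbolicMetric

/-! ### Powers of an element of infinite order. -/

namespace IsHyperbolicMetric

variable {G : Type*} [Group G] {d : G → G → ℕ} {δ : ℕ}

theorem dist_one_pow_le (H : IsHyperbolicMetric d δ) (a : G) (n : ℕ) :
    d 1 (a ^ n) ≤ n * d 1 a := by
  induction n with
  | zero => simp [H.self]
  | succ n ih =>
    have h1 := H.triangle 1 (a ^ n) (a ^ (n + 1))
    have h2 := H.mul_left (a ^ n) 1 a
    rw [mul_one, ← pow_succ] at h2
    rw [add_mul, one_mul]
    omega

/-- A power of an element of infinite order has large displacement growth at some point. -/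
theorem exists_pow_displacement (H : IsHyperbolicMetric d δ) {a : G} (ha : ¬ IsOfFinOrder a) :
    ∃ m x, d x (a ^ m * x) + 2 * δ < d x (a ^ (2 * m) * x) := by
  classical
  have hinj : Function.Injective fun n : ℕ => a ^ n := injective_pow_iff_not_isOfFinOrder.2 ha
  by_contra! hcon
  set R := 20 * δ
  set I := (H.finite_ball R).toFinset.card
  set T := 2 * I * d 1 a with hT
  have hpow : ∀ i ≤ 2 * I, d 1 (a ^ i) ≤ T := fun i hi =>
    (H.dist_one_pow_le a i).trans (Nat.mul_le_mul_right _ hi)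
  obtain ⟨M, hM⟩ : ∃ M, 4 * T + 20 * δ + 20 < d 1 (a ^ M) := by
    by_contra! hall
    refine Set.infinite_range_of_injective hinj ((H.finite_ball (4 * T + 20 * δ + 20)).subset ?_)
    rintro _ ⟨n, rfl⟩
    exact hall n
  set e := a ^ M with he
  obtain ⟨p, hp0, hpn, hp⟩ := H.exists_geodesic 1 e
  set i₀ := d 1 e / 2
  set x := p i₀ with hx
  have hx1 : d 1 x = i₀ := by
    have := hp 0 i₀ (Nat.zero_le _) (by omega)
    rwa [hp0] at this
  have hx2 : d x e = d 1 e - i₀ := by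
    have := hp i₀ (d 1 e) (by omega) le_rfl
    rwa [hpn] at this
  have hbx : d 1 x + d x e ≤ d 1 e + 2 * δ := by omega
  have hfrom : ∀ i y, d (a ^ i) (a ^ i * y) = d 1 y := fun i y => by
    simpa using H.mul_left (a ^ i) 1 y
  have hto : ∀ i y, d (a ^ i * y) (a ^ i * e) = d y e := fun i y => H.mul_left _ _ _
  have he' : ∀ i, d e (a ^ i * e) = d 1 (a ^ i) := fun i => by
    have : a ^ i * e = e * a ^ i := (Commute.refl a).pow_pow i M
    rw [this]
    simpa using H.mul_left e 1 (a ^ i)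
  -- Since `a ^ i` commutes with `e`, it moves 1 and `e` equally little, so the midpoint `x` stays
  -- near the geodesic.
  have hbt : ∀ i ≤ 2 * I, d 1 (a ^ i * x) + d (a ^ i * x) e ≤ d 1 e + 2 * δ := by
    intro i hi
    have h1 := hpow i hi
    have h2 := hfrom i x
    have h3 := hto i x
    have h4 := hfrom i e
    have h5 := he' i
    have h0 : d (a ^ i) (a ^ i * x) + d (a ^ i * x) (a ^ i * e) ≤ d (a ^ i) (a ^ i * e) + 0 := by
      omega
    have h6 := H.between_of_far (x' := 1) h0 (by rw [H.symm (a ^ i) 1]; omega)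
    have h7 := H.between_of_far (x' := e) (H.between_symm h6)
      (by rw [H.symm (a ^ i * e) e, H.symm (a ^ i * e) (a ^ i * x)]; omega)
    have := H.between_symm h7
    omega
  -- Near the geodesic `a ^ i` acts almost as a translation, so a larger displacement would nearly
  -- double under `a ^ (2 * i)`, against `hcon`.
  have hsmall : ∀ i ≤ I, d x (a ^ i * x) ≤ R := by
    intro i hi
    by_contra! hlarge
    have hdisp := hcon i x
    have hpi := hpow i (by omega)
    have hby := hbt i (by omega)
    have hbz := hbt (2 * i) (by omega)
    have h2i : a ^ (2 * i) = a ^ i * a ^ i := by rw [two_mul, pow_add]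
    have f1 := hfrom i x
    have f2 := hfrom i (a ^ i * x)
    rw [← mul_assoc, ← h2i] at f2
    have f3 : d (a ^ i * x) (a ^ (2 * i) * x) = d x (a ^ i * x) := by
      rw [h2i, mul_assoc, H.mul_left]
    have f4 := hpow (2 * i) (by omega)
    have q1 := H.four_point 1 (a ^ i) (a ^ i * x) (a ^ (2 * i) * x)
    have q2 := H.four_point 1 (a ^ i) (a ^ (2 * i) * x) (a ^ i * x)
    have s1 := H.symm (a ^ (2 * i) * x) (a ^ i * x)
    have t4 := H.triangle 1 x (a ^ (2 * i) * x)
    have t5 := H.triangle 1 (a ^ (2 * i) * x) x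
    have s2 := H.symm (a ^ (2 * i) * x) x
    have g1 := hfrom (2 * i) x
    have t6 := H.triangle (a ^ (2 * i)) 1 (a ^ (2 * i) * x)
    have s4 := H.symm (a ^ (2 * i)) 1
    have near := H.dist_le_of_between (r := max (d 1 x - d 1 (a ^ i * x)) (d 1 (a ^ i * x) - d 1 x))
      hbx hby (by omega) (by omega)
    rcases q1 with q1 | q1 <;> rcases q2 with q2 | q2 <;> omega
  -- Pigeonhole: `I + 1` conjugated powers lie in a ball with `I` elements.
  have hnot : ¬ Set.InjOn (fun i : ℕ => x⁻¹ * a ^ i * x) (Finset.range (I + 1)) := by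
    intro h
    have hsub : (Finset.range (I + 1)).image (fun i : ℕ => x⁻¹ * a ^ i * x) ⊆
        (H.finite_ball R).toFinset := by
      intro g hg
      obtain ⟨i, hi, rfl⟩ := Finset.mem_image.1 hg
      rw [Finset.mem_range] at hi
      rw [Set.Finite.mem_toFinset, Set.mem_ofPred_eq]
      have := hsmall i (by omega)
      rw [← H.mul_left x]
      simpa [mul_assoc] using this
    have := Finset.card_le_card hsub
    rw [Finset.card_image_of_injOn h, Finset.card_range] at this
    omega
  refine hnot fun i _ j _ hij => hinj ?_
  simpa using hij

/-- Some power `b` of an element of infinite order generates a quasi-geodesic subgroup. -/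
theorem exists_quasigeodesic_pow (H : IsHyperbolicMetric d δ) {a : G} (ha : ¬ IsOfFinOrder a) :
    ∃ m C : ℕ, (∀ n : ℕ, n ≤ d 1 ((a ^ m) ^ n) + C) ∧
      ∀ i j : ℕ, d 1 ((a ^ m) ^ i) + d 1 ((a ^ m) ^ j) ≤ d 1 ((a ^ m) ^ (i + j)) + C := by
  obtain ⟨m, x, hdisp⟩ := H.exists_pow_displacement ha
  rw [mul_comm 2 m, pow_mul] at hdisp
  -- Each of three distances costs `2 * d 1 x` when the orbit of `x` replaces that of 1; the rest is
  -- the global error of the orbit of `x`.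
  refine ⟨m, 6 * d 1 x + (2 * d x (a ^ m * x) - d x ((a ^ m) ^ 2 * x) + 2 * δ), ?_⟩
  generalize a ^ m = b at hdisp ⊢
  set u : ℤ → G := fun i => b ^ i * x with hu
  have hstep : ∀ i k : ℤ, d (u i) (u (i + k)) = d x (b ^ k * x) := by
    intro i k
    simp only [hu]
    rw [zpow_add, mul_assoc, H.mul_left]
  have hstep1 : ∀ i, d (u i) (u (i + 1)) = d x (b * x) := fun i => by simpa using hstep i 1
  have hstep2 : ∀ i, d (u i) (u (i + 2)) = d x (b ^ 2 * x) := fun i => by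
    have := hstep i 2
    rwa [show b ^ (2 : ℤ) = b ^ 2 from zpow_ofNat b 2] at this
  have htri := H.triangle x (b * x) (b ^ 2 * x)
  have hbx : d (b * x) (b ^ 2 * x) = d x (b * x) := by rw [pow_two, mul_assoc, H.mul_left]
  have hloc : ∀ i, d (u i) (u (i + 1)) + d (u (i + 1)) (u (i + 2)) ≤
      d (u i) (u (i + 2)) + (2 * d x (b * x) - d x (b ^ 2 * x)) := by
    intro i
    have h1 := hstep1 i
    have h2 := hstep1 (i + 1)
    rw [add_assoc, show (1 : ℤ) + 1 = 2 by norm_num] at h2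
    have h3 := hstep2 i
    omega
  have hlong : ∀ i, 2 * d x (b * x) - d x (b ^ 2 * x) + 2 * δ < d (u i) (u (i + 1)) := by
    intro i
    rw [hstep1]
    omega
  have hnear : ∀ i, d (b ^ i) (u i) = d 1 x := fun i => by simpa using H.mul_left (b ^ i) 1 x
  have hcmp : ∀ i j, d (b ^ i) (b ^ j) ≤ d (u i) (u j) + 2 * d 1 x ∧
      d (u i) (u j) ≤ d (b ^ i) (b ^ j) + 2 * d 1 x := by
    intro i j
    have := hnear i
    have := hnear j
    have := H.triangle (b ^ i) (u i) (b ^ j)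
    have := H.triangle (u i) (u j) (b ^ j)
    have := H.triangle (u i) (b ^ i) (u j)
    have := H.triangle (b ^ i) (b ^ j) (u j)
    have := H.symm (u i) (b ^ i)
    have := H.symm (u j) (b ^ j)
    omega
  refine ⟨fun n => ?_, fun i j => ?_⟩
  · have h1 := H.le_dist_of_local hloc hlong 0 n
    have h2 := (hcmp 0 (0 + n)).2
    rw [zero_add] at h1 h2
    rw [zpow_zero, zpow_natCast] at h2
    omega
  · have h1 := H.between_of_local hloc hlong (i := 0) (j := i) (k := (i + j : ℕ))
      (by omega) (by omega)
    have h2 := hcmp 0 i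
    have h3 := hcmp i (i + j : ℕ)
    have h4 := hcmp 0 (i + j : ℕ)
    have h5 := H.mul_left (b ^ i) 1 (b ^ j)
    rw [mul_one, ← pow_add] at h5
    simp only [zpow_zero, zpow_natCast] at h2 h3 h4
    omega

end IsHyperbolicMetric

/-- The geodesics from `1` to `h` fellow-travel translates of the orbit of `⟨b⟩` only for a time
that is bounded by `T`. -/
def HasBoundedOverlap {G : Type*} [Group G] (d : G → G → ℕ) (b : G) (T : ℕ → ℕ) (h : G) : Prop :=
  ∀ (C : ℕ) (t : G) (n : ℕ), d 1 t + d t h ≤ d 1 h + C →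
    d 1 (t * b ^ n) + d (t * b ^ n) h ≤ d 1 h + C → n ≤ T C

/-! ### Bounded overlap and straight corners. -/

namespace IsHyperbolicMetric

variable {G : Type*} [Group G] {d : G → G → ℕ} {δ : ℕ}

theorem dist_pow_pow (H : IsHyperbolicMetric d δ) (g b : G) {i j : ℕ} (h : i ≤ j) :
    d (g * b ^ i) (g * b ^ j) = d 1 (b ^ (j - i)) := by
  rw [H.mul_left, ← H.mul_left (b ^ i) 1, mul_one, ← pow_add, Nat.add_sub_cancel' h]

theorem dist_one_inv (H : IsHyperbolicMetric d δ) (g : G) : d 1 g⁻¹ = d 1 g := by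
  rw [← H.mul_left g, mul_inv_cancel, mul_one, H.symm]

/-- Translation by `h` reverses the geodesic and exchanges the ends of the overlap. This handles the
corners of the axis at powers of `w`. -/
theorem hasBoundedOverlap_inv (H : IsHyperbolicMetric d δ) {b h : G} {T : ℕ → ℕ}
    (hT : HasBoundedOverlap d b T h) : HasBoundedOverlap d b⁻¹ T h⁻¹ := by
  intro C t n h1 h2
  have flip : ∀ s, d 1 s + d s h⁻¹ ≤ d 1 h⁻¹ + C → d 1 (h * s) + d (h * s) h ≤ d 1 h + C := by
    intro s hs
    have e1 := H.mul_left h 1 s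
    have e2 := H.mul_left h s h⁻¹
    have e3 := H.mul_left h 1 h⁻¹
    rw [mul_inv_cancel] at e2 e3
    rw [mul_one] at e1 e3
    have := H.symm h 1
    have := H.symm h (h * s)
    have := H.symm 1 (h * s)
    omega
  refine hT C (h * (t * b⁻¹ ^ n)) n (flip _ h2) ?_
  have : h * (t * b⁻¹ ^ n) * b ^ n = h * t := by group
  rw [this]
  exact flip _ h1

/-- Serious backtracking at the corner `h` would put `h * b ^ k` near `[1, h]` for `k = T (C₀ + δ) +
1`, an overlap that is too long. -/
theorem between_of_hasBoundedOverlap (H : IsHyperbolicMetric d δ) {b h : G} {T : ℕ → ℕ} {C₀ : ℕ}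
    (hb : ∀ i j : ℕ, d 1 (b ^ i) + d 1 (b ^ j) ≤ d 1 (b ^ (i + j)) + C₀)
    (hT : HasBoundedOverlap d b T h) (n : ℕ) :
    d 1 h + d h (h * b ^ n) ≤ d 1 (h * b ^ n) + 2 * ((T (C₀ + δ) + 1) * d 1 b) := by
  have hfrom : ∀ i, d h (h * b ^ i) = d 1 (b ^ i) := fun i => by simpa using H.mul_left h 1 (b ^ i)
  set k := T (C₀ + δ) + 1 with hk
  by_contra! hcon
  have hnk : k ≤ n := by
    by_contra! hlt
    have h1 := H.triangle 1 (h * b ^ n) h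
    have h2 := H.symm (h * b ^ n) h
    have h3 := H.dist_one_pow_le b n
    have h4 : n * d 1 b ≤ k * d 1 b := Nat.mul_le_mul_right _ hlt.le
    have := hfrom n
    omega
  have h1 := H.dist_one_pow_le b k
  have h2 := H.dist_pow_pow h b hnk
  have h3 := hb k (n - k)
  rw [Nat.add_sub_cancel' hnk] at h3
  have h4 := hfrom k
  have h5 := hfrom n
  have h6 : k ≤ T (C₀ + δ) := by
    refine hT _ h k ?_ ?_
    · rw [H.self]; omega
    · have := H.symm h (h * b ^ k)
      have := H.symm (h * b ^ n) h
      have := H.symm (h * b ^ n) (h * b ^ k)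
      have := H.symm (h * b ^ k) 1
      have := H.symm (h * b ^ n) 1
      rcases H.four_point h 1 (h * b ^ n) (h * b ^ k) with h' | h'
      · rw [H.symm h 1] at h'
        omega
      · omega
  omega

/-! ### The axis of `h * b ^ K` and its centraliser. -/

section Axis

variable {b h w : G} {T : ℕ → ℕ} {C₀ : ℕ} {x : ℤ → G}

/-- Corners at odd indices are straight by bounded overlap for `h` and `b`, those at even indices by
the same for `h⁻¹` and `b⁻¹`. The size conditions make the steps long enough for the local-to-global
principle. -/
theorem exists_axis (H : IsHyperbolicMetric d δ) {K : ℕ}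
    (hb : ∀ i j : ℕ, d 1 (b ^ i) + d 1 (b ^ j) ≤ d 1 (b ^ (i + j)) + C₀)
    (hT : HasBoundedOverlap d b T h)
    (hK : 2 * ((T (C₀ + δ) + 1) * d 1 b) + 2 * δ < d 1 (b ^ K))
    (hN : 2 * ((T (C₀ + δ) + 1) * d 1 b) + 2 * δ < d 1 h) :
    ∃ x : ℤ → G, (∀ n, x (2 * n) = (h * b ^ K) ^ n) ∧ (∀ n, x (2 * n + 1) = (h * b ^ K) ^ n * h) ∧
      (∀ i (n : ℕ), n ≤ d (x i) (x (i + n))) ∧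
      ∀ i j k, i ≤ j → j ≤ k → d (x i) (x j) + d (x j) (x k) ≤
        d (x i) (x k) + (2 * ((T (C₀ + δ) + 1) * d 1 b) + 2 * δ) := by
  have c1 := H.between_of_hasBoundedOverlap hb hT K
  have c2 := H.between_of_hasBoundedOverlap (b := b⁻¹) (C₀ := C₀)
    (by simpa only [inv_pow, H.dist_one_inv] using hb) (H.hasBoundedOverlap_inv hT) K
  rw [H.dist_one_inv b] at c2
  set C := 2 * ((T (C₀ + δ) + 1) * d 1 b)
  set w := h * b ^ K with hw
  set x : ℤ → G := fun i => w ^ (i / 2) * if i % 2 = 0 then 1 else h with hx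
  have hx0 : ∀ n, x (2 * n) = w ^ n := fun n => by
    simp [hx]
  have hx1 : ∀ n, x (2 * n + 1) = w ^ n * h := fun n => by
    have e1 : (2 * n + 1) / 2 = n := by omega
    have e2 : (2 * n + 1) % 2 = 1 := by omega
    simp [hx, e1]
  have hstep0 : ∀ n, d (x (2 * n)) (x (2 * n + 1)) = d 1 h := fun n => by
    rw [hx0, hx1]
    simpa using H.mul_left (w ^ n) 1 h
  have hstep1 : ∀ n, d (x (2 * n + 1)) (x (2 * n + 2)) = d 1 (b ^ K) := fun n => by
    rw [show 2 * n + 2 = 2 * (n + 1) by ring, hx0, hx1, zpow_add_one, hw, ← mul_assoc]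
    simpa using H.mul_left (w ^ n * h) 1 (b ^ K)
  have hlong : ∀ i, C + 2 * δ < d (x i) (x (i + 1)) := by
    intro i
    obtain ⟨n, rfl | rfl⟩ := Int.even_or_odd' i
    · rwa [hstep0]
    · rw [show 2 * n + 1 + 1 = 2 * n + 2 by ring]
      rwa [hstep1]
  have hloc : ∀ i, d (x i) (x (i + 1)) + d (x (i + 1)) (x (i + 2)) ≤ d (x i) (x (i + 2)) + C := by
    intro i
    obtain ⟨n, rfl | rfl⟩ := Int.even_or_odd' i
    · rw [hstep0, hstep1, show 2 * n + 2 = 2 * (n + 1) by ring, hx0, hx0, zpow_add_one]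
      have e1 := H.mul_left (w ^ n) 1 w
      have e2 := H.mul_left h 1 (b ^ K)
      rw [mul_one] at e1 e2
      rw [← hw] at e2
      omega
    · rw [show 2 * n + 1 + 1 = 2 * n + 2 by ring, show 2 * n + 1 + 2 = 2 * (n + 1) + 1 by ring,
        hstep1, show 2 * n + 2 = 2 * (n + 1) by ring, hstep0, hx1, hx1, zpow_add_one]
      have e1 := H.mul_left (w ^ n * w * h⁻¹⁻¹) (h⁻¹ * b⁻¹ ^ K) 1
      have e2 : w ^ n * w * h⁻¹⁻¹ * (h⁻¹ * b⁻¹ ^ K) = w ^ n * h := by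
        simp [hw, mul_assoc]
      rw [e2, mul_one, inv_inv] at e1
      have e3 := H.mul_left h⁻¹ 1 (b⁻¹ ^ K)
      rw [mul_one, inv_pow, H.dist_one_inv (b ^ K), ← inv_pow] at e3
      have e4 := H.dist_one_inv h
      have e5 := H.symm 1 (h⁻¹ * b⁻¹ ^ K)
      omega
  exact ⟨x, hx0, hx1, H.le_dist_of_local hloc hlong,
    fun i j k hij hjk => H.between_of_local hloc hlong hij hjk⟩

/-- An element that commutes with `w = h * b ^ K` preserves the axis of `w` together with its
decomposition into translates of the segments `[1, h]` and `[h, h * b ^ K]`. -/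
theorem exists_zpow_dist_le (H : IsHyperbolicMetric d δ) {K C₂ C₄ q : ℕ}
    (hlin : ∀ n : ℕ, n ≤ d 1 (b ^ n) + C₀)
    (hb : ∀ i j : ℕ, d 1 (b ^ i) + d 1 (b ^ j) ≤ d 1 (b ^ (i + j)) + C₀)
    (hT : HasBoundedOverlap d b T h) (hw : w = h * b ^ K)
    (hx0 : ∀ n, x (2 * n) = w ^ n) (hx1 : ∀ n, x (2 * n + 1) = w ^ n * h)
    (hxlin : ∀ i (n : ℕ), n ≤ d (x i) (x (i + n)))
    (hxb : ∀ i j k, i ≤ j → j ≤ k → d (x i) (x j) + d (x j) (x k) ≤ d (x i) (x k) + C₂)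
    (hC₄ : C₄ = 2 * C₂ + 2 * C₀ + 2 * δ)
    (hq : q = T (2 * (C₄ + δ)) + 1 + C₄ + C₀)
    (hK : q ≤ K) (hN : d 1 (b ^ K) + C₂ ≤ d 1 h) {c : G} (hc : Commute c w) :
    ∃ n : ℤ, d (w ^ n * h) (c * h) ≤ q * d 1 b + C₂ + 2 * C₄ + δ := by
  set L := d 1 (b ^ K) with hL
  -- So large that `e = w ^ (-M)` and `f = w ^ (M + 1)` are far from `h` compared with `d 1 c`, the
  -- distance by which `c` moves each of them.
  set M := d 1 c + L + d 1 h + 2 * C₂ + 2 * C₀ + 2 * C₄ + 2 * δ + 1 with hM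
  set e := x (2 * (-M : ℤ)) with he
  set f := x (2 * (M + 1 : ℤ)) with hf
  have hce : d e (c * e) = d 1 c := by
    rw [he, hx0, (hc.zpow_right _).eq]
    simpa using H.mul_left (w ^ (-M : ℤ)) 1 c
  have hcf : d f (c * f) = d 1 c := by
    rw [hf, hx0, (hc.zpow_right _).eq]
    simpa using H.mul_left (w ^ (M + 1 : ℤ)) 1 c
  have hxh : x 1 = h := by simpa using hx1 0
  have hxw : x 2 = h * b ^ K := by simpa [hw] using hx0 1
  -- the segment from `h` to `h * b ^ K`
  have hseg : ∀ i j, i ≤ j → d (h * b ^ i) (h * b ^ j) = d 1 (b ^ (j - i)) :=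
    fun i j => H.dist_pow_pow h b
  have hfrom : ∀ i, d h (h * b ^ i) = d 1 (b ^ i) := fun i => by simpa using H.mul_left h 1 (b ^ i)
  have heh : 2 * M ≤ d e h := by
    have := hxlin (2 * (-M : ℤ)) (2 * M + 1)
    rw [show 2 * (-M : ℤ) + (2 * M + 1 : ℕ) = 1 by push_cast; ring, hxh, ← he] at this
    omega
  have hwf : 2 * M ≤ d (h * b ^ K) f := by
    have := hxlin 2 (2 * M)
    rwa [show (2 : ℤ) + (2 * M : ℕ) = 2 * (M + 1) by push_cast; ring, hxw] at this
  have heK := hxb (2 * (-M : ℤ)) 1 2 (by omega) (by omega)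
  have heKf := hxb (2 * (-M : ℤ)) 2 (2 * (M + 1)) (by omega) (by omega)
  rw [hxh, hxw, ← he, hfrom] at heK
  rw [hxw, ← he, ← hf] at heKf
  have hseg_end : ∀ i ≤ K, d 1 (b ^ i) + d 1 (b ^ (K - i)) ≤ L + C₀ := fun i hi => by
    have := hb i (K - i)
    rwa [Nat.add_sub_cancel' hi] at this
  have heq : ∀ i ≤ K, d e h + d 1 (b ^ i) ≤ d e (h * b ^ i) + (C₂ + C₀) := fun i hi => by
    have h1 := hseg_end i hi
    have h2 := hseg i K hi
    have h3 := H.triangle e (h * b ^ i) (h * b ^ K)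
    omega
  have heqf : ∀ i ≤ K, d e (h * b ^ i) + d (h * b ^ i) f ≤ d e f + (2 * C₂ + 2 * C₀) := by
    intro i hi
    have h1 := hseg_end i hi
    have h2 := hseg i K hi
    have h3 := H.triangle e h (h * b ^ i)
    have h4 := H.triangle (h * b ^ i) (h * b ^ K) f
    have h5 := hfrom i
    omega
  have heqq : ∀ i j, i ≤ j → j ≤ K → d e (h * b ^ i) + d (h * b ^ i) (h * b ^ j) ≤
      d e (h * b ^ j) + (2 * C₂ + 2 * C₀) := by
    intro i j hij hj
    have h1 := heq j hj
    have h2 := hseg i j hij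
    have h3 := H.triangle e h (h * b ^ i)
    have h4 := hb i (j - i)
    rw [Nat.add_sub_cancel' hij] at h4
    have h5 := hfrom i
    omega
  -- its translate by `c`
  set z : ℕ → G := fun i => c * (h * b ^ i) with hz
  have hzb : ∀ i j, z j = z i * b ^ (j - i) ∨ j < i := fun i j => by
    rcases le_or_gt i j with h' | h'
    · left
      simp only [hz]
      rw [mul_assoc, mul_assoc, ← pow_add, Nat.add_sub_cancel' h']
    · exact Or.inr h'
  have hzz : ∀ i j, i ≤ j → d (z i) (z j) = d 1 (b ^ (j - i)) := fun i j hij => by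
    simp only [hz]
    rw [H.mul_left, hseg i j hij]
  have hez : ∀ i, d (c * e) (z i) = d e (h * b ^ i) := fun i => H.mul_left _ _ _
  have hzf : ∀ i, d (z i) (c * f) = d (h * b ^ i) f := fun i => H.mul_left _ _ _
  have hefc : d (c * e) (c * f) = d e f := H.mul_left _ _ _
  have hsce := H.symm (c * e) e
  have hscf := H.symm (c * f) f
  have hzmono : ∀ i j, i ≤ j → j ≤ K → d e (z i) + d 1 (b ^ (j - i)) ≤ d e (z j) + C₄ := by
    intro i j hij hj
    have h1 := heqq i j hij hj
    have h2 := heq i (hij.trans hj)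
    have h3 := hzz i j hij
    have h4 := hseg i j hij
    rw [h4, ← h3, ← hez, ← hez] at h1
    have := H.between_of_far (x' := e) h1 (by rw [hez]; omega)
    omega
  have hzax : ∀ i ≤ K, d e (z i) + d (z i) f ≤ d e f + C₄ := by
    intro i hi
    have h1 := heqf i hi
    have h2 := heq i hi
    have h3 := hseg_end i hi
    have h4 := hseg i K hi
    have h5 := H.triangle (h * b ^ K) (h * b ^ i) f
    have h6 := H.symm (h * b ^ K) (h * b ^ i)
    have h7 := H.triangle (h * b ^ i) (h * b ^ K) f
    rw [← hez, ← hzf, ← hefc] at h1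
    have h9 := H.between_of_far (x' := e) h1 (by rw [hez]; omega)
    have h10 := H.symm (c * f) (z i)
    have h11 := hzf i
    have := H.between_of_far (x' := f) (H.between_symm h9) (by omega)
    have := H.between_symm this
    omega
  have hxax : ∀ j, 2 * (-M : ℤ) ≤ j → j ≤ 2 * (M + 1 : ℤ) →
      d e (x j) + d (x j) f ≤ d e f + C₄ := fun j h1 h2 => by
    have := hxb _ j _ h1 h2
    rw [← he, ← hf] at this
    omega
  have hstep : ∀ i j, i ≤ j → d 1 (b ^ (j - i)) ≤ (j - i) * d 1 b ∧
      d e (z j) ≤ d e (z i) + d 1 (b ^ (j - i)) := fun i j hij => by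
    have := H.triangle e (z i) (z j)
    have := hzz i j hij
    exact ⟨H.dist_one_pow_le b _, by omega⟩
  have hstep0 : ∀ n, d (x (2 * n)) (x (2 * n + 1)) = d 1 h := fun n => by
    rw [hx0, hx1]
    simpa using H.mul_left (w ^ n) 1 h
  have hstep1 : ∀ n, d (x (2 * n + 1)) (x (2 * n + 2)) = L := fun n => by
    rw [show 2 * n + 2 = 2 * (n + 1) by ring, hx0, hx1, zpow_add_one]
    have := H.mul_left (w ^ n * h) 1 (b ^ K)
    rwa [mul_one, mul_assoc, ← hw] at this
  -- the translate of `[h, h * b ^ K]` does not run along a translate of `[1, h]` for long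
  have hover : ∀ (n : ℤ) (i j : ℕ), -M ≤ n → n ≤ M → i + q ≤ j → j ≤ K →
      d e (x (2 * n)) ≤ d e (z i) → d e (z i) ≤ d e (x (2 * n + 1)) →
      d e (x (2 * n)) ≤ d e (z j) → d e (z j) ≤ d e (x (2 * n + 1)) → False := by
    intro n i j hn hn' hij hj a1 a2 a3 a4
    have hbt : ∀ k ≤ K, d e (x (2 * n)) ≤ d e (z k) → d e (z k) ≤ d e (x (2 * n + 1)) →
        d 1 (w ^ (-n) * z k) + d (w ^ (-n) * z k) h ≤ d 1 h + 2 * (C₄ + δ) := by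
      intro k hk b1 b2
      have e1 := H.mul_left (w ^ n) 1 (w ^ (-n) * z k)
      have e2 := H.mul_left (w ^ n) (w ^ (-n) * z k) h
      have e0 : w ^ n * (w ^ (-n) * z k) = z k := by rw [zpow_neg, mul_inv_cancel_left]
      rw [mul_one, e0, ← hx0 n] at e1
      rw [e0, ← hx1 n] at e2
      have e3 := H.dist_le_of_between (r := d e (z k) - d e (x (2 * n)))
        (hxax (2 * n) (by omega) (by omega)) (hzax k hk) (by omega) (by omega)
      have e4 := H.dist_le_of_between (r := d e (x (2 * n + 1)) - d e (z k))
        (hzax k hk) (hxax (2 * n + 1) (by omega) (by omega)) (by omega) (by omega)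
      have e5 := H.triangle e (x (2 * n)) (x (2 * n + 1))
      rw [hstep0] at e5
      omega
    have := hT (2 * (C₄ + δ)) (w ^ (-n) * z i) (j - i) (hbt i (by omega) a1 a2) (by
      rw [mul_assoc, ← (hzb i j).resolve_right (by omega)]
      exact hbt j hj a3 a4)
    omega
  -- The first period of the axis, measured by distance from `e`, that contains `z 0 = c * h`.
  obtain ⟨n, hn, hn', hlow, hup⟩ : ∃ n : ℤ, -M ≤ n ∧ n < M ∧ d e (x (2 * n)) ≤ d e (z 0) ∧
      d e (z 0) ≤ d e (x (2 * n + 2)) := by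
    have hlast : d e (z 0) ≤ d e (x (2 * M)) := by
      have h1 := hxb (2 * (-M : ℤ)) 1 (2 * M) (by omega) (by omega)
      rw [hxh, ← he] at h1
      have h2 := hxlin 1 (2 * M - 1)
      rw [show (1 : ℤ) + (2 * M - 1 : ℕ) = 2 * M by omega, hxh] at h2
      have h3 : d c (z 0) = d 1 h := by
        simpa [hz] using H.mul_left c 1 h
      have h4 := H.triangle e h (z 0)
      have h5 := H.triangle h 1 (z 0)
      have h6 := H.triangle 1 c (z 0)
      have h7 := H.symm h 1
      omega
    classical
    have hex : ∃ k : ℕ, d e (z 0) ≤ d e (x (2 * (-M + k : ℤ) + 2)) := by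
      refine ⟨2 * M - 1, ?_⟩
      rwa [show 2 * (-M + (2 * M - 1 : ℕ) : ℤ) + 2 = 2 * M by omega]
    have hkM : Nat.find hex ≤ 2 * M - 1 := Nat.find_min' hex (by
      rwa [show 2 * (-M + (2 * M - 1 : ℕ) : ℤ) + 2 = 2 * M by omega])
    refine ⟨-M + Nat.find hex, by omega, by omega, ?_, Nat.find_spec hex⟩
    rcases Nat.eq_zero_or_pos (Nat.find hex) with h0 | hpos
    · rw [h0, Nat.cast_zero, add_zero, ← he, H.self]
      exact Nat.zero_le _
    · have := Nat.find_min hex (Nat.sub_lt hpos one_pos)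
      rw [show 2 * (-M + (Nat.find hex - 1 : ℕ) : ℤ) + 2 = 2 * (-M + Nat.find hex) by omega] at this
      omega
  -- `q` exceeds the allowed overlap, and `q` powers of `b` advance by at least `C₄`, which absorbs
  -- the error in `hzmono`.
  have hqlin := hlin q
  refine ⟨n, ?_⟩
  have hz0 : c * h = z 0 := by simp [hz]
  rw [← hx1, hz0]
  have hax0 := hzax 0 (Nat.zero_le _)
  have hax1 := hxax (2 * n + 1) (by omega) (by omega)
  rcases le_or_gt (d e (z 0)) (d e (x (2 * n + 1))) with hcase | hcase
  -- If `z 0` lies on an `h`-segment, `z q` must have left it, so `z 0` is near its end.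
  · have h1 := hzmono 0 q (Nat.zero_le _) hK
    have h2 := hstep 0 q (Nat.zero_le _)
    rw [Nat.sub_zero] at h1 h2
    have h3 : d e (x (2 * n + 1)) < d e (z q) := by
      by_contra! hle
      exact hover n 0 q hn hn'.le (by omega) hK hlow hcase (by omega) hle
    have := H.dist_le_of_between (r := q * d 1 b) hax1 hax0 (by omega) (by omega)
    omega
  -- If `z 0` lies far along a `b`-segment, the last `q` steps of its translate run along the next
  -- `h`-segment, which by `hN` is too long to be overshot.
  · have h1 := hzmono 0 K (Nat.zero_le _) le_rfl
    have h2 := hstep 0 K (Nat.zero_le _)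
    have h3 := hzmono (K - q) K (by omega) le_rfl
    have h4 := hstep (K - q) K (by omega)
    rw [Nat.sub_zero] at h1 h2
    rw [Nat.sub_sub_self hK] at h3 h4
    have h5 := H.triangle e (x (2 * n + 1)) (x (2 * n + 2))
    rw [hstep1] at h5
    have h6 := hxb (2 * (-M : ℤ)) (2 * (n + 1)) (2 * (n + 1) + 1) (by omega) (by omega)
    rw [hstep0, ← he] at h6
    have h7 : d e (z 0) ≤ d e (x (2 * n + 1)) + (q * d 1 b + C₂ + C₄) := by
      by_contra! hlt
      rw [show 2 * n + 2 = 2 * (n + 1) by ring] at *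
      exact hover (n + 1) (K - q) K (by omega) (by omega) (by omega) le_rfl
        (by omega) (by omega) (by omega) (by omega)
    have := H.dist_le_of_between (r := q * d 1 b + C₂ + C₄) hax1 hax0 (by omega) (by omega)
    omega

end Axis

/-! ### Excluding proper powers. -/

theorem exists_not_isProperPower (H : IsHyperbolicMetric d δ) {b : G} {C₀ : ℕ}
    (hlin : ∀ n : ℕ, n ≤ d 1 (b ^ n) + C₀)
    (hb : ∀ i j : ℕ, d 1 (b ^ i) + d 1 (b ^ j) ≤ d 1 (b ^ (i + j)) + C₀) (T : ℕ → ℕ) :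
    ∃ K N : ℕ, ∀ h, HasBoundedOverlap d b T h → N < d 1 h → ¬ IsProperPower (h * b ^ K) := by
  set C₂ := 2 * ((T (C₀ + δ) + 1) * d 1 b) + 2 * δ with hC₂
  set C₄ := 2 * C₂ + 2 * C₀ + 2 * δ with hC₄
  set q := T (2 * (C₄ + δ)) + 1 + C₄ + C₀ with hq
  set B := q * d 1 b + C₂ + 2 * C₄ + δ with hB
  -- Makes `d 1 (b ^ K)` exceed `3 * B + C₂`, so distinct points `w ^ n * h` are more than `3 * B`
  -- apart.
  set K := q + C₂ + C₀ + 3 * B + 1 with hK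
  refine ⟨K, d 1 (b ^ K) + C₂, fun h hT hN => ?_⟩
  have hKlin := hlin K
  obtain ⟨x, hx0, hx1, hxlin, hxb⟩ := H.exists_axis (K := K) hb hT (by omega) (by omega)
  rw [← hC₂] at hxb
  rintro ⟨g, p, hp, hgp⟩
  have key : ∀ c, Commute c (h * b ^ K) → ∃ n : ℤ, d ((h * b ^ K) ^ n * h) (c * h) ≤ B :=
    fun c hc => H.exists_zpow_dist_le hlin hb hT rfl hx0 hx1 hxlin hxb hC₄ hq (by omega)
      (by omega) hc
  have hKd := H.mul_left h 1 (b ^ K)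
  rw [mul_one] at hKd
  set w := h * b ^ K with hw
  have hpos : ∀ n : ℤ, 0 < n → 3 * B < d h (w ^ n * h) := by
    intro n hn
    have h1 := hxb 1 2 (2 * n + 1) (by omega) (by omega)
    rw [hx1, show x 1 = h by simpa using hx1 0, show x 2 = w by simpa using hx0 1] at h1
    omega
  have hne : ∀ n : ℤ, d h (w ^ n * h) ≤ 3 * B → n = 0 := by
    intro n hn
    rcases lt_trichotomy n 0 with h0 | h0 | h0
    · have h1 := hpos (-n) (by omega)
      rw [← H.mul_left (w ^ n), zpow_neg, mul_inv_cancel_left, H.symm] at h1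
      omega
    · exact h0
    · have := hpos n h0
      omega
  -- The next power moves `h` by at most `2 * B` and is `B`-close to some `w ^ n * h`. Hence that
  -- point is within `3 * B` of `h`, so `n = 0` and the bound `B` is restored.
  have hpow : ∀ c, Commute c w → d h (c * h) ≤ B → ∀ k : ℕ, d h (c ^ k * h) ≤ B := by
    intro c hc hcB k
    induction k with
    | zero => simp [H.self]
    | succ k ih =>
      have h1 := H.mul_left (c ^ k) h (c * h)
      rw [← mul_assoc, ← pow_succ] at h1
      have h2 := H.triangle h (c ^ k * h) (c ^ (k + 1) * h)
      obtain ⟨n, hn⟩ := key (c ^ (k + 1)) (hc.pow_left _)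
      have h3 := H.triangle h (c ^ (k + 1) * h) (w ^ n * h)
      have h4 := H.symm (c ^ (k + 1) * h) (w ^ n * h)
      obtain rfl := hne n (by omega)
      rw [zpow_zero, one_mul] at hn h4
      omega
  have hgw : Commute g w := hgp ▸ Commute.self_pow g p
  obtain ⟨n, hn⟩ := key g hgw
  have hcw : Commute (w ^ (-n) * g) w := ((Commute.refl w).zpow_left _).mul_left hgw
  have h1 := hpow _ hcw (by
    rw [← H.mul_left (w ^ n), ← mul_assoc, ← mul_assoc, ← zpow_add, add_neg_cancel, zpow_zero,
      one_mul]
    exact hn) p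
  rw [((hgw.symm.zpow_left (-n))).mul_pow, hgp, ← zpow_natCast, ← zpow_mul, ← zpow_add_one] at h1
  have h2 := hne (-n * p + 1) (by omega)
  have h3 : n * (p : ℤ) = 1 := by linarith
  have h4 := Int.eq_one_or_neg_one_of_mul_eq_one' h3
  omega

end IsHyperbolicMetric

/-! ### Shortest coset representatives have bounded overlap. -/

section MinimalRepresentatives

variable {X Y G : Type*} [Group G]

/-- If `h` is a shortest representative of its coset modulo a normal subgroup that contains `b`,
then its geodesics fellow-travel translates of the orbit of `⟨b⟩` only for a bounded time. -/
theorem exists_hasBoundedOverlap [Finite X] [Finite Y] {φ : FreeGroup X →* G}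
    (hφ : Function.Surjective φ) {ψ : FreeGroup Y →* G} (hψ : Function.Surjective ψ) {δ : ℕ}
    (H : IsHyperbolicMetric (wordDist ψ) δ) (N : Subgroup G) [N.Normal] {b : G} (hbN : b ∈ N)
    {C₀ : ℕ} (hlin : ∀ n : ℕ, n ≤ wordDist ψ 1 (b ^ n) + C₀) :
    ∃ T : ℕ → ℕ, ∀ h : G,
      wordDist φ 1 h = wordDist ((QuotientGroup.mk' N).comp φ) 1 (QuotientGroup.mk' N h) →
      HasBoundedOverlap (wordDist ψ) b T h := by
  obtain ⟨μ, hμ⟩ := exists_wordLength_le_mul hψ hφ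
  obtain ⟨c, hc⟩ := exists_wordLength_le_mul hφ hψ
  have hμ' : ∀ x y, wordDist ψ x y ≤ μ * wordDist φ x y := fun x y => hμ _
  have hc' : ∀ x y, wordDist φ x y ≤ c * wordDist ψ x y := fun x y => hc _
  obtain ⟨D, hD⟩ := H.exists_morse_constant μ c
  refine ⟨fun C => 2 * (D + 2 * C) + μ * (2 * (c * (D + 2 * C))) + C₀, ?_⟩
  intro h hmin C t n ht htn
  set π := QuotientGroup.mk' N with hπ
  have hQ : Function.Surjective (π.comp φ) := (QuotientGroup.mk'_surjective N).comp hφ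
  obtain ⟨p, hp0, hpn, hp⟩ := exists_isGeodesicPath hφ 1 h
  set m := wordDist φ 1 h with hm
  -- Constant after time `m`, since `exists_morse_constant` bounds the steps at all times.
  set u : ℕ → G := fun i => p (min i m) with hu
  have hud : ∀ i j, i ≤ j → j ≤ m → wordDist φ (u i) (u j) = j - i := by
    intro i j hij hj
    simp only [hu]
    rw [min_eq_left hj, min_eq_left (hij.trans hj), hp i j hij hj]
  have hu0 : u 0 = 1 := by simp [hu, hp0]
  have hum : u m = h := by simp [hu, hpn]
  have hstep : ∀ i, wordDist ψ (u i) (u (i + 1)) ≤ μ := by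
    intro i
    have h1 : wordDist φ (u i) (u (i + 1)) ≤ 1 := by
      simp only [hu]
      rw [hp _ _ (by omega) (min_le_right _ _)]
      omega
    simpa using (hμ' _ _).trans (Nat.mul_le_mul_left μ h1)
  have hqi : ∀ i j, i ≤ j → j ≤ m → j - i ≤ c * wordDist ψ (u i) (u j) := fun i j hij hj => by
    rw [← hud i j hij hj]
    exact hc' _ _
  have hmorse := hD u m hstep hqi C
  rw [hu0, hum] at hmorse
  obtain ⟨k, hk, hkt⟩ := hmorse t ht
  obtain ⟨l, hl, hlt⟩ := hmorse (t * b ^ n) htn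
  -- in the quotient, the two points of the geodesic are close
  have hπb : π (b ^ n) = 1 := (QuotientGroup.eq_one_iff _).2 (N.pow_mem hbN n)
  have hclose : wordLength (π.comp φ) (π ((u k)⁻¹ * u l)) ≤ 2 * (c * (D + 2 * C)) := by
    have e1 : π ((u k)⁻¹ * u l) = π ((u k)⁻¹ * t) * π ((t * b ^ n)⁻¹ * u l) := by
      simp only [map_mul, map_inv, hπb]
      group
    rw [e1, two_mul]
    refine (wordLength_mul_le hQ _ _).trans (add_le_add ?_ ?_)
    · refine (wordLength_comp_le hφ π _).trans ((hc' (u k) t).trans (Nat.mul_le_mul_left c ?_))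
      rwa [H.symm]
    · exact (wordLength_comp_le hφ π _).trans ((hc' _ _).trans (Nat.mul_le_mul_left c hlt))
  -- A shortcut in the quotient between two points of the geodesic would shorten the image of `h`,
  -- against `hmin`.
  have hfull : ∀ i j, i ≤ j → j ≤ m → j - i ≤ wordLength (π.comp φ) (π ((u i)⁻¹ * u j)) := by
    intro i j hij hj
    have e1 : π h = π ((u 0)⁻¹ * u i) * (π ((u i)⁻¹ * u j) * π ((u j)⁻¹ * u m)) := by
      rw [← map_mul, ← map_mul, hu0, hum]
      congr 1
      group
    have e2 : m = wordLength (π.comp φ) (π h) := by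
      rw [hmin, wordDist, inv_one, one_mul]
    rw [e1] at e2
    have e3 := wordLength_mul_le hQ (π ((u 0)⁻¹ * u i)) (π ((u i)⁻¹ * u j) * π ((u j)⁻¹ * u m))
    have e4 := wordLength_mul_le hQ (π ((u i)⁻¹ * u j)) (π ((u j)⁻¹ * u m))
    have e5 := wordLength_comp_le hφ π ((u 0)⁻¹ * u i)
    have e6 := wordLength_comp_le hφ π ((u j)⁻¹ * u m)
    have e7 := hud 0 i (Nat.zero_le _) (hij.trans hj)
    have e8 := hud j m hj le_rfl
    rw [wordDist] at e7 e8
    omega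
  have hφkl : wordDist φ (u k) (u l) ≤ 2 * (c * (D + 2 * C)) := by
    rcases le_total k l with h | h
    · rw [hud k l h hl]
      exact (hfull k l h hl).trans hclose
    · rw [wordDist_comm hφ, hud l k h hk]
      refine (hfull l k h hk).trans ?_
      rw [← wordLength_inv hQ, ← map_inv]
      simpa using hclose
  have e1 := (hμ' (u k) (u l)).trans (Nat.mul_le_mul_left μ hφkl)
  have e2 := H.triangle t (u k) (t * b ^ n)
  have e3 := H.triangle (u k) (u l) (t * b ^ n)
  have e4 := H.symm (u l) (t * b ^ n)
  have e5 := H.mul_left t 1 (b ^ n)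
  rw [mul_one] at e5
  have e6 := hlin n
  show n ≤ 2 * (D + 2 * C) + μ * (2 * (c * (D + 2 * C))) + C₀
  omega

end MinimalRepresentatives

theorem mainTheorem4 {G : Type*} [Group G] (hG : IsHyperbolicGroup G)
    {X : Type*} [Finite X] (φ : FreeGroup X →* G) (hφ : Function.Surjective φ)
    (a : G) (ha : ¬ IsOfFinOrder a) :
    ∃ K N : ℕ, ∀ h : G,
      wordDist φ 1 h =
        wordDist ((QuotientGroup.mk' (Subgroup.normalClosure {a})).comp φ) 1
          (QuotientGroup.mk' (Subgroup.normalClosure {a}) h) →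
      N < wordDist φ 1 h →
      ¬ IsProperPower (h * a ^ K) := by
  obtain ⟨r, ψ, hψ, δ, hδ⟩ := hG
  have H := hδ.isHyperbolicMetric hψ
  obtain ⟨m, C₀, hlin, hb⟩ := H.exists_quasigeodesic_pow ha
  have ham : a ^ m ∈ Subgroup.normalClosure {a} :=
    Subgroup.pow_mem _ (Subgroup.subset_normalClosure (Set.mem_singleton a)) m
  obtain ⟨T, hT⟩ := exists_hasBoundedOverlap hφ hψ H _ ham hlin
  obtain ⟨K, N, hKN⟩ := H.exists_not_isProperPower hlin hb T
  obtain ⟨c, hc⟩ := exists_wordLength_le_mul hφ hψ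
  -- The factor `m` converts powers of `a ^ m` to powers of `a`; `c` converts the length threshold
  -- from `ψ` to `φ`.
  refine ⟨m * K, c * N, fun h hmin hN => ?_⟩
  rw [pow_mul a m K]
  refine hKN h (hT h hmin) (lt_of_mul_lt_mul_left (hN.trans_le (hc _)) (Nat.zero_le c))
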